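/- For integers $n,k,\ell,m\ge 0$ let $A_4(n;k,\ell,m)$ denote the number of partitions $\lambda=(\lambda_1\ge\lambda_2\ge\cdots)$ of $n$ having exactly $k$, $\ell$ and $m$ parts congruent to $1$, $2$ and $3$ modulo $4$, respectively, with no part equal to $3$, and such that every two consecutive parts satisfy $\lambda_i-\lambda_{i+1}\ge 5$ whenever (i) $\lambda_i\equiv 3 \pmod 4$, or (ii) $\lambda_i\equiv 0,1\pmod 4$ and $\lambda_{i+1}\equiv 1,2\pmod 4$. Write $(x;q)_\infty=\prod_{i\ge 0}(1-xq^i)$. Then, as formal power series in $q,a,c,d$, $$\sum_{n,k,\ell,m\ge 0}A_4(n;k,\ell,m)\,q^n a^k c^\ell d^m=\frac{(-aq;q^8)_\infty(-dq^7;q^8)_\infty}{(q^4;q^4)_\infty(cq^2;q^8)_\infty}.$$ In other words, if $B_4(n;k,\ell,m)$ denotes the number of partitions of $n$ into even parts not congruent to $6$ modulo $8$ and distinct odd parts congruent to $\pm1$ modulo $8$, having exactly $k$, $\ell$ and $m$ parts congruent to $1$, $2$ and $7$ modulo $8$, respectively, then $A_4(n;k,\ell,m)=B_4(n;k,\ell,m)$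 for all $n,k,\ell,m\ge 0$. -/

import Mathlib

open scoped MvPowerSeries.WithPiTopology

/-- The infinite `q`-Pochhammer symbol `(x; q)_∞ = ∏_{i ≥ 0} (1 - x q^i)`. -/
noncomputable def qPochInf {R : Type*} [CommRing R] [TopologicalSpace R] (x q : R) : R :=
  ∏' i : ℕ, (1 - x * q ^ i)

/-- The number of parts of the partition `p` that are congruent to `r` modulo `M`. -/
def numPartsMod {n : ℕ} (p : n.Partition) (M r : ℕ) : ℕ :=
  p.parts.countP (fun x => x ≡ r [MOD M])

/-- The difference condition on consecutive parts `x = λ_i ≥ y = λ_{i+1}`: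
`x - y ≥ 5` if `x ≡ 3 (mod 4)`, or if `x ≡ 0, 1 (mod 4)` and `y ≡ 1, 2 (mod 4)`. -/
def GapCondition (x y : ℕ) : Prop :=
  (x % 4 = 3 ∨ ((x % 4 = 0 ∨ x % 4 = 1) ∧ (y % 4 = 1 ∨ y % 4 = 2))) → y + 5 ≤ x

instance (x y : ℕ) : Decidable (GapCondition x y) := by
  unfold GapCondition; infer_instance

/-- The number `A₄(n; k, ℓ, m)` of partitions `λ₁ ≥ λ₂ ≥ ⋯` of `n` with `k`, `ℓ`, `m` parts
congruent to `1`, `2`, `3` modulo `4`, with no part equal to `3`, whose consecutive parts all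
satisfy the difference condition. -/
def A4 (n k l m : ℕ) : ℕ :=
  (Finset.univ.filter (fun p : n.Partition =>
    numPartsMod p 4 1 = k ∧ numPartsMod p 4 2 = l ∧ numPartsMod p 4 3 = m ∧
    3 ∉ p.parts ∧ (p.parts.sort (· ≥ ·)).IsChain GapCondition)).card

/-- The number `B₄(n; k, ℓ, m)` of partitions of `n` into even parts not congruent to `6` modulo
`8` and distinct odd parts congruent to `±1` modulo `8`, with `k`, `ℓ`, `m` parts congruent to
`1`, `2`, `7` modulo `8`. -/
def B4 (n k l m : ℕ) : ℕ :=
  (Finset.univ.filter (fun p : n.Partition =>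
    numPartsMod p 8 1 = k ∧ numPartsMod p 8 2 = l ∧ numPartsMod p 8 7 = m ∧
    (∀ x ∈ p.parts, (Even x ∧ x % 8 ≠ 6) ∨
      (p.parts.count x = 1 ∧ (x % 8 = 1 ∨ x % 8 = 7))))).card

/-- The generating function `∑ A₄(n; k, ℓ, m) qⁿ aᵏ cˡ dᵐ`, as a formal power series in
`q = X 0`, `a = X 1`, `c = X 2`, `d = X 3`. -/
noncomputable def A4GenFun : MvPowerSeries (Fin 4) ℤ :=
  fun e => (A4 (e 0) (e 1) (e 2) (e 3) : ℤ)

/-! Both generating functions, multiplied by the denominator of the product side, equal its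
numerator; the denominator is a unit, so they agree.

For `A4`, write parts in increasing order, padded in front with zeros to length `s`, and follow a
virtual part `0`. Raising all `s` parts by 4 respects the gap condition and multiplies weights by
`q^(4s)`; chains that may follow `x` but not `x + 4` have one of four first entries. This gives a
linear system (`gapGenFun_succ`) for the series of chains following 0 and 1. Multiplying by `(q⁴;
q⁴)ₛ` and eliminating the second unknown leaves the recurrence of `gapPoly` with `A = aq`, `C =
cq²`, `E = dq⁷`, `p = q⁸` (`prod_mul_gapGenFun`).

The polynomials `gapPoly` satisfy contiguous relations for `A → Ap`, `E → Ep`, `C → Cp`. As `s → ∞`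
these become `g(A, C, E)(1 - C) = (1 + A)(1 + E) g(Ap, Cp, Ep)`, and iterating produces the product.
The limit is taken modulo `q^K`, where it is attained at a finite stage
(`pow_dvd_gapPoly_mul_prod_sub`).

For `B4`, the product is built up one admissible part size at a time (`productGenFun_mul_prod`). -/

/-- The polynomials defined by `g₀ = 1`, `g₁ = 1 + A + C + E` and
`gₛ₊₂ = (1 + C + (A + E) pˢ⁺¹) gₛ₊₁ + (1 - pˢ⁺¹) (A E pˢ - C) gₛ`. -/
def gapPoly {R : Type*} [CommRing R] (A C E p : R) : ℕ → R
  | 0 => 1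
  | 1 => 1 + A + C + E
  | s + 2 => (1 + C + (A + E) * p ^ (s + 1)) * gapPoly A C E p (s + 1) +
      (1 - p ^ (s + 1)) * (A * E * p ^ s - C) * gapPoly A C E p s

/-! ### Contiguous relations for `gapPoly`. -/

section GapPoly

variable {R : Type*} [CommRing R] (A C E p : R)

theorem gapPoly_swap (s : ℕ) : gapPoly A C E p s = gapPoly E C A p s := by
  induction s using Nat.twoStepInduction with
  | zero => rfl
  | one => simp only [gapPoly]; ring
  | more s ih₁ ih₂ => simp only [gapPoly, ih₁, ih₂]; ring

theorem map_gapPoly {S : Type*} [CommRing S] (f : R →+* S) (s : ℕ) :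
    f (gapPoly A C E p s) = gapPoly (f A) (f C) (f E) (f p) s := by
  induction s using Nat.twoStepInduction with
  | zero => simp [gapPoly]
  | one => simp [gapPoly]
  | more s ih₁ ih₂ => simp [gapPoly, ih₁, ih₂]

theorem gapPoly_zero (s : ℕ) : gapPoly 0 0 0 p s = 1 := by
  induction s using Nat.twoStepInduction with
  | zero => simp [gapPoly]
  | one => simp [gapPoly]
  | more s ih₁ ih₂ => simp [gapPoly, ih₂]

/-- Two-step induction through the defining recurrence. Once `p ^ (s + 1)` vanishes and the sequence
is stationary, this reads `g(A) = (1 + A) g(Ap)`. -/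
theorem gapPoly_succ_eq_left (s : ℕ) :
    gapPoly A C E p (s + 1) =
      gapPoly (A * p) C E p (s + 1) + A * (1 - p ^ (s + 1)) * gapPoly (A * p) C E p s := by
  induction s using Nat.twoStepInduction with
  | zero => simp only [gapPoly]; ring
  | one => simp only [gapPoly]; ring
  | more s ih₁ ih₂ =>
    rw [gapPoly, ih₁, ih₂]
    simp only [gapPoly]
    ring

theorem gapPoly_succ_eq_right (s : ℕ) :
    gapPoly A C E p (s + 1) =
      gapPoly A C (E * p) p (s + 1) + E * (1 - p ^ (s + 1)) * gapPoly A C (E * p) p s := by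
  simpa only [gapPoly_swap A] using gapPoly_succ_eq_left E C A p s

/-- Here the shifted polynomial is expressed by the unshifted one, the reverse of the relations for
`A` and `E`; this is what puts `1 - C` in the denominator of the product. -/
theorem gapPoly_succ_eq_middle (s : ℕ) :
    gapPoly A (C * p) E p (s + 1) =
      gapPoly A C E p (s + 1) - C * (1 - p ^ (s + 1)) * gapPoly A C E p s := by
  induction s using Nat.twoStepInduction with
  | zero => simp only [gapPoly]; ring
  | one => simp only [gapPoly]; ring
  | more s ih₁ ih₂ =>
    rw [gapPoly, ih₁, ih₂]
    simp only [gapPoly]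
    ring

end GapPoly

/-! ### The limit of `gapPoly` when `q` is nilpotent. -/

section Nilpotent

variable {R : Type*} [CommRing R] {q A C E p : R}

theorem pow_eq_zero_of_dvd {K n : ℕ} {x : R} (hq : q ^ K = 0) (hx : q ∣ x) (hn : K ≤ n) :
    x ^ n = 0 := by
  obtain ⟨y, rfl⟩ := hx
  rw [mul_pow, pow_eq_zero_of_le hn hq, zero_mul]

theorem pow_dvd_gapPoly_succ_sub (hA : q ∣ A) (hC : q ∣ C) (hp : q ∣ p) (s : ℕ) :
    q ^ s ∣ gapPoly A C E p (s + 1) - gapPoly A C E p s := by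
  induction s with
  | zero => simp
  | succ s ih =>
    -- Each summand carries `s + 1` factors divisible by `q`: `C` times the previous difference, `p
    -- ^ s * p`, or `p ^ s * A`.
    have h : gapPoly A C E p (s + 2) - gapPoly A C E p (s + 1) =
        C * (gapPoly A C E p (s + 1) - gapPoly A C E p s) +
          (p ^ s * p * ((A + E) * gapPoly A C E p (s + 1)
            - (A * E * p ^ s - C) * gapPoly A C E p s) + p ^ s * A * (E * gapPoly A C E p s)) := by
      rw [gapPoly]; ring
    rw [h, pow_succ]
    have h₁ : q ^ s ∣ p ^ s := pow_dvd_pow_of_dvd hp s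
    refine dvd_add ?_ (dvd_add ((mul_dvd_mul h₁ hp).mul_right _)
      ((mul_dvd_mul h₁ hA).mul_right _))
    rw [mul_comm]
    exact mul_dvd_mul hC ih

theorem gapPoly_eq_of_le {K : ℕ} (hq : q ^ K = 0) (hA : q ∣ A) (hC : q ∣ C) (hp : q ∣ p) {s : ℕ}
    (hs : K ≤ s) : gapPoly A C E p s = gapPoly A C E p K := by
  induction s, hs using Nat.le_induction with
  | base => rfl
  | succ s hs ih =>
    have h := pow_dvd_gapPoly_succ_sub (E := E) hA hC hp s
    rw [pow_eq_zero_of_le hs hq, zero_dvd_iff, sub_eq_zero] at h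
    rw [h, ih]

/-- Indices `K` and `K + 1` give the same value, so the three contiguous relations become
multiplications by `1 + A`, `1 + E` and `1 - C`, and can be composed. -/
theorem gapPoly_eq_shift {K : ℕ} (hq : q ^ K = 0) (hA : q ∣ A) (hC : q ∣ C)
    (hp : q ∣ p) :
    gapPoly A C E p K * (1 - C) =
      (1 + A) * (1 + E) * gapPoly (A * p) (C * p) (E * p) p K := by
  have hp0 : p ^ (K + 1) = 0 := pow_eq_zero_of_dvd hq hp (Nat.le_succ K)
  have h₁ := gapPoly_succ_eq_left A C E p K
  have h₂ := gapPoly_succ_eq_right (A * p) C E p K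
  have h₃ := gapPoly_succ_eq_middle (A * p) C (E * p) p K
  rw [hp0, gapPoly_eq_of_le hq hA hC hp (Nat.le_succ K),
    gapPoly_eq_of_le hq (hA.mul_right p) hC hp (Nat.le_succ K)] at h₁
  rw [hp0, gapPoly_eq_of_le hq (hA.mul_right p) hC hp (Nat.le_succ K),
    gapPoly_eq_of_le hq (hA.mul_right p) hC hp (Nat.le_succ K)] at h₂
  rw [hp0, gapPoly_eq_of_le hq (hA.mul_right p) (hC.mul_right p) hp (Nat.le_succ K),
    gapPoly_eq_of_le hq (hA.mul_right p) hC hp (Nat.le_succ K)] at h₃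
  linear_combination (1 - C) * h₁ + (1 - C) * (1 + A) * h₂ - (1 + A) * (1 + E) * h₃

theorem gapPoly_mul_prod {K : ℕ} (hq : q ^ K = 0) (hA : q ∣ A) (hC : q ∣ C)
    (hp : q ∣ p) (N : ℕ) :
    gapPoly A C E p K * ∏ i ∈ Finset.range N, (1 - C * p ^ i) =
      (∏ i ∈ Finset.range N, (1 + A * p ^ i)) * (∏ i ∈ Finset.range N, (1 + E * p ^ i)) *
        gapPoly (A * p ^ N) (C * p ^ N) (E * p ^ N) p K := by
  induction N with
  | zero => simp
  | succ N ih =>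
    have h := gapPoly_eq_shift (E := E * p ^ N) hq (hA.mul_right (p ^ N)) (hC.mul_right (p ^ N)) hp
    simp only [Finset.prod_range_succ, pow_succ, ← mul_assoc]
    linear_combination (1 - C * p ^ N) * ih + (∏ i ∈ Finset.range N, (1 + A * p ^ i)) *
      (∏ i ∈ Finset.range N, (1 + E * p ^ i)) * h

theorem gapPoly_mul_prod_eq {K s N : ℕ} (hq : q ^ K = 0) (hA : q ∣ A) (hC : q ∣ C)
    (hp : q ∣ p) (hs : K ≤ s) (hN : K ≤ N) :
    gapPoly A C E p s * ∏ i ∈ Finset.range N, (1 - C * p ^ i) =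
      (∏ i ∈ Finset.range N, (1 + A * p ^ i)) * (∏ i ∈ Finset.range N, (1 + E * p ^ i)) := by
  rw [gapPoly_eq_of_le hq hA hC hp hs, gapPoly_mul_prod hq hA hC hp N,
    -- `p ^ N = 0` kills all three shifted arguments, and `gapPoly 0 0 0 p` is 1.
    pow_eq_zero_of_dvd hq hp hN]
  simp [gapPoly_zero]

end Nilpotent

/-- The product formula for `gapPoly` holds modulo `q ^ K`. -/
theorem pow_dvd_gapPoly_mul_prod_sub {R : Type*} [CommRing R] {q A C E p : R} {K s N : ℕ}
    (hA : q ∣ A) (hC : q ∣ C) (hp : q ∣ p) (hs : K ≤ s) (hN : K ≤ N) :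
    q ^ K ∣ gapPoly A C E p s * ∏ i ∈ Finset.range N, (1 - C * p ^ i) -
      (∏ i ∈ Finset.range N, (1 + A * p ^ i)) * (∏ i ∈ Finset.range N, (1 + E * p ^ i)) := by
  let f := Ideal.Quotient.mk (Ideal.span {q ^ K})
  have hq : f q ^ K = 0 := by
    rw [← map_pow, Ideal.Quotient.eq_zero_iff_mem]
    exact Ideal.mem_span_singleton_self _
  rw [← Ideal.mem_span_singleton, ← Ideal.Quotient.eq_zero_iff_mem]
  change f _ = 0
  simp only [map_sub, map_mul, map_prod, map_add, map_one, map_pow, map_gapPoly, sub_eq_zero]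
  exact gapPoly_mul_prod_eq hq (map_dvd f hA) (map_dvd f hC) (map_dvd f hp) hs hN

/-! ### Generating functions of weighted sets. -/

/-- The generating function `∑_{x ∈ S} X ^ wt x`, for a weight with finite fibres on `S`. -/
noncomputable def setGenFun {α : Type*} (wt : α → Fin 4 →₀ ℕ) (S : Set α) :
    MvPowerSeries (Fin 4) ℤ :=
  fun e => ({x ∈ S | wt x = e}.ncard : ℤ)

section SetGenFun

open MvPowerSeries

variable {α β : Type*} {wt : α → Fin 4 →₀ ℕ}

theorem coeff_setGenFun (S : Set α) (e : Fin 4 →₀ ℕ) :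
    coeff e (setGenFun wt S) = ({x ∈ S | wt x = e}.ncard : ℤ) := rfl

theorem setGenFun_singleton (x : α) : setGenFun wt {x} = monomial (wt x) 1 := by
  classical
  ext e
  rw [coeff_setGenFun, coeff_monomial]
  split_ifs with h
  · have : {y ∈ ({x} : Set α) | wt y = e} = {x} := by
      ext y; simp only [Set.mem_ofPred_eq, Set.mem_singleton_iff]
      exact ⟨fun h => h.1, fun hy => ⟨hy, hy ▸ h.symm⟩⟩
    rw [this]; simp
  · have : {y ∈ ({x} : Set α) | wt y = e} = ∅ := by
      ext y; simp only [Set.mem_ofPred_eq, Set.mem_singleton_iff, Set.mem_empty_iff_false, iff_false]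
      rintro ⟨rfl, hy⟩
      exact h hy.symm
    rw [this]; simp

theorem setGenFun_union {S T : Set α} (hST : Disjoint S T)
    (hS : ∀ e, {x ∈ S | wt x = e}.Finite) (hT : ∀ e, {x ∈ T | wt x = e}.Finite) :
    setGenFun wt (S ∪ T) = setGenFun wt S + setGenFun wt T := by
  ext e
  rw [map_add, coeff_setGenFun, coeff_setGenFun, coeff_setGenFun, ← Nat.cast_add,
    ← Set.ncard_union_eq (hST.mono (fun _ h => h.1) (fun _ h => h.1)) (hS e) (hT e)]
  congr 2
  ext x
  simp only [Set.mem_ofPred_eq, Set.mem_union, or_and_right]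

theorem setGenFun_biUnion {ι : Type*} {S : ι → Set α} (s : Finset ι)
    (hd : ∀ i ∈ s, ∀ j ∈ s, i ≠ j → Disjoint (S i) (S j))
    (hS : ∀ i ∈ s, ∀ e, {x ∈ S i | wt x = e}.Finite) :
    setGenFun wt (⋃ i ∈ s, S i) = ∑ i ∈ s, setGenFun wt (S i) := by
  classical
  induction s using Finset.induction_on with
  | empty => ext e; simp [coeff_setGenFun]
  | insert i s hi ih =>
    rw [Finset.sum_insert hi, Finset.set_biUnion_insert, setGenFun_union, ih]
    · exact fun j hj k hk => hd j (Finset.mem_insert_of_mem hj) k (Finset.mem_insert_of_mem hk)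
    · exact fun j hj => hS j (Finset.mem_insert_of_mem hj)
    · rw [Set.disjoint_iUnion₂_right]
      intro j hj
      exact hd i (Finset.mem_insert_self i s) j (Finset.mem_insert_of_mem hj)
        (fun h => hi (h ▸ hj))
    · exact hS i (Finset.mem_insert_self i s)
    · intro e
      refine (s.finite_toSet.biUnion fun j hj =>
        hS j (Finset.mem_insert_of_mem hj) e).subset ?_
      rintro x ⟨hx, hxe⟩
      simp only [Set.mem_iUnion] at hx ⊢
      obtain ⟨j, hj, hx⟩ := hx
      exact ⟨j, hj, hx, hxe⟩

theorem setGenFun_image {wt' : β → Fin 4 →₀ ℕ} {S : Set α} {f : α → β} (hf : f.Injective)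
    {w : Fin 4 →₀ ℕ} (hw : ∀ x ∈ S, wt' (f x) = w + wt x) :
    setGenFun wt' (f '' S) = monomial w 1 * setGenFun wt S := by
  classical
  ext e
  rw [coeff_setGenFun, coeff_monomial_mul]
  split_ifs with h
  · rw [one_mul, coeff_setGenFun, ← Set.ncard_image_of_injective _ hf]
    congr 2
    ext y
    constructor
    · rintro ⟨⟨x, hx, rfl⟩, hy⟩
      refine ⟨x, ⟨hx, ?_⟩, rfl⟩
      rw [← hy, hw x hx, add_tsub_cancel_left]
    · rintro ⟨x, ⟨hx, hy⟩, rfl⟩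
      exact ⟨⟨x, hx, rfl⟩, by rw [hw x hx, hy, add_tsub_cancel_of_le h]⟩
  · have : {y ∈ f '' S | wt' y = e} = ∅ := by
      rw [Set.eq_empty_iff_forall_notMem]
      rintro _ ⟨⟨x, hx, rfl⟩, hy⟩
      exact h (by rw [← hy, hw x hx]; exact le_self_add)
    rw [this]; simp

end SetGenFun

/-! ### Weights of parts and multisets. -/

/-- The exponent of a part `x`: the size `x`, and whether `x ≡ 1, 2, r (mod M)`. -/
noncomputable def partWeight (M r x : ℕ) : Fin 4 →₀ ℕ :=
  Finsupp.single 0 x + Finsupp.single 1 (if x ≡ 1 [MOD M] then 1 else 0) +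
    Finsupp.single 2 (if x ≡ 2 [MOD M] then 1 else 0) +
    Finsupp.single 3 (if x ≡ r [MOD M] then 1 else 0)

/-- The total exponent of a multiset of parts. -/
noncomputable def multisetWeight (M r : ℕ) (s : Multiset ℕ) : Fin 4 →₀ ℕ :=
  (s.map (partWeight M r)).sum

section Weight

open MvPowerSeries

variable (M r : ℕ)

theorem multisetWeight_cons (x : ℕ) (s : Multiset ℕ) :
    multisetWeight M r (x ::ₘ s) = partWeight M r x + multisetWeight M r s := by
  simp [multisetWeight]

theorem multisetWeight_apply (s : Multiset ℕ) :
    multisetWeight M r s 0 = s.sum ∧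
    multisetWeight M r s 1 = s.countP (fun x => x ≡ 1 [MOD M]) ∧
    multisetWeight M r s 2 = s.countP (fun x => x ≡ 2 [MOD M]) ∧
    multisetWeight M r s 3 = s.countP (fun x => x ≡ r [MOD M]) := by
  induction s using Multiset.induction_on with
  | empty => simp [multisetWeight]
  | cons x s ih =>
    obtain ⟨h₀, h₁, h₂, h₃⟩ := ih
    simp only [multisetWeight_cons, Finsupp.add_apply, h₀, h₁, h₂, h₃, Multiset.countP_cons,
      Multiset.sum_cons, partWeight]
    simp [add_comm]

theorem multisetWeight_eq_iff (s : Multiset ℕ) (e : Fin 4 →₀ ℕ) :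
    multisetWeight M r s = e ↔ s.sum = e 0 ∧ s.countP (fun x => x ≡ 1 [MOD M]) = e 1 ∧
      s.countP (fun x => x ≡ 2 [MOD M]) = e 2 ∧ s.countP (fun x => x ≡ r [MOD M]) = e 3 := by
  obtain ⟨h₀, h₁, h₂, h₃⟩ := multisetWeight_apply M r s
  rw [Finsupp.ext_iff, Fin.forall_fin_succ, Fin.forall_fin_succ, Fin.forall_fin_succ,
    Fin.forall_fin_succ]
  simp [← h₀, ← h₁, ← h₂, ← h₃]

theorem monomial_partWeight (x : ℕ) :
    (monomial (partWeight M r x) 1 : MvPowerSeries (Fin 4) ℤ) =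
      X 0 ^ x * X 1 ^ (if x ≡ 1 [MOD M] then 1 else 0) *
        X 2 ^ (if x ≡ 2 [MOD M] then 1 else 0) * X 3 ^ (if x ≡ r [MOD M] then 1 else 0) := by
  simp only [X_pow_eq, monomial_mul_monomial, partWeight, mul_one]

end Weight

/-! ### Chains of parts and their shift by 4. -/

/-- The relation between a part `x` and the next larger part `y`. -/
def GapRel (x y : ℕ) : Prop := x ≤ y ∧ GapCondition y x

theorem gapRel_add_four {x y : ℕ} : GapRel (x + 4) (y + 4) ↔ GapRel x y := by
  unfold GapRel GapCondition; omega

theorem GapRel.of_add_four {x y : ℕ} (h : GapRel (x + 4) y) : GapRel x y := by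
  unfold GapRel GapCondition at *; omega

/-- The lists of `s` numbers which, preceded by `x`, are chains for `GapRel`. -/
def gapLists (s x : ℕ) : Set (List ℕ) := {l | l.length = s ∧ (x :: l).IsChain GapRel}

/-- The generating function of `gapLists s x`. -/
noncomputable def gapGenFun (s x : ℕ) : MvPowerSeries (Fin 4) ℤ :=
  setGenFun (fun l : List ℕ => multisetWeight 4 3 l) (gapLists s x)

theorem gapLists_zero (x : ℕ) : gapLists 0 x = {[]} := by
  ext l
  simp only [gapLists, Set.mem_ofPred_eq, Set.mem_singleton_iff, List.length_eq_zero_iff]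
  constructor
  · exact fun h => h.1
  · rintro rfl; simp

theorem cons_mem_gapLists {s x y : ℕ} {l : List ℕ} :
    y :: l ∈ gapLists (s + 1) x ↔ GapRel x y ∧ l ∈ gapLists s y := by
  simp only [gapLists, Set.mem_ofPred_eq, List.length_cons, List.isChain_cons_cons,
    Nat.add_right_cancel_iff]
  tauto

theorem exists_cons_of_mem_gapLists {s x : ℕ} {l : List ℕ} (h : l ∈ gapLists (s + 1) x) :
    ∃ y l', l = y :: l' ∧ GapRel x y ∧ l' ∈ gapLists s y := by
  cases l with
  | nil => simp [gapLists] at h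
  | cons y l => exact ⟨y, l, rfl, cons_mem_gapLists.1 h⟩

theorem gapLists_add_four (s x : ℕ) :
    gapLists s (x + 4) = List.map (· + 4) '' gapLists s x := by
  induction s generalizing x with
  | zero => simp [gapLists_zero]
  | succ s ih =>
    ext l
    constructor
    · intro h
      obtain ⟨y, l, rfl, hy, hl⟩ := exists_cons_of_mem_gapLists h
      obtain ⟨y, rfl⟩ : ∃ z, y = z + 4 := ⟨y - 4, by have := hy.1; omega⟩
      rw [ih] at hl
      obtain ⟨l, hl, rfl⟩ := hl
      exact ⟨y :: l, cons_mem_gapLists.2 ⟨gapRel_add_four.1 hy, hl⟩, rfl⟩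
    · rintro ⟨l, h, rfl⟩
      obtain ⟨y, l, rfl, hy, hl⟩ := exists_cons_of_mem_gapLists h
      rw [List.map_cons, cons_mem_gapLists, ih]
      exact ⟨gapRel_add_four.2 hy, l, hl, rfl⟩

theorem partWeight_add_four (x : ℕ) :
    partWeight 4 3 (x + 4) = Finsupp.single 0 4 + partWeight 4 3 x := by
  have h (r : ℕ) : x + 4 ≡ r [MOD 4] ↔ x ≡ r [MOD 4] := by
    unfold Nat.ModEq; omega
  simp only [partWeight, h, Finsupp.single_add]
  abel

theorem multisetWeight_map_add_four (l : List ℕ) :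
    multisetWeight 4 3 (l.map (· + 4) : List ℕ) =
      Finsupp.single 0 (4 * l.length) + multisetWeight 4 3 l := by
  induction l with
  | nil => simp [multisetWeight]
  | cons x l ih =>
    rw [List.map_cons, ← Multiset.cons_coe, ← Multiset.cons_coe, multisetWeight_cons,
      multisetWeight_cons, ih, partWeight_add_four, List.length_cons, Nat.mul_succ,
      Finsupp.single_add]
    abel

theorem finite_list_length_sum (s n : ℕ) : {l : List ℕ | l.length = s ∧ l.sum = n}.Finite := by
  refine ((List.finite_length_eq (Fin (n + 1)) s).image (List.map Fin.val)).subset ?_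
  rintro l ⟨hl, hn⟩
  have h : ∀ x ∈ l, x < n + 1 := fun x hx => by
    have := List.single_le_sum (fun _ _ => Nat.zero_le _) x hx
    omega
  refine ⟨l.pmap Fin.mk h, by simpa using hl, ?_⟩
  simp [List.map_pmap]

theorem finite_gapLists_weight (s x : ℕ) (e : Fin 4 →₀ ℕ) :
    {l ∈ gapLists s x | multisetWeight 4 3 (l : Multiset ℕ) = e}.Finite := by
  refine (finite_list_length_sum s (e 0)).subset ?_
  rintro l ⟨⟨hl, -⟩, he⟩
  refine ⟨hl, ?_⟩
  rw [← ((multisetWeight_eq_iff 4 3 _ e).1 he).1, Multiset.sum_coe]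

/-! ### Recurrences for the chain generating functions. -/

section Recurrence

open MvPowerSeries

theorem gapGenFun_zero (x : ℕ) : gapGenFun 0 x = 1 := by
  rw [gapGenFun, gapLists_zero, setGenFun_singleton]
  rfl

theorem gapGenFun_add_four (s x : ℕ) : gapGenFun s (x + 4) = (X 0 ^ 4) ^ s * gapGenFun s x := by
  have h : setGenFun (fun l : List ℕ => multisetWeight 4 3 l) (List.map (· + 4) '' gapLists s x) =
      monomial (Finsupp.single 0 (4 * s)) 1 * gapGenFun s x := by
    refine setGenFun_image (List.map_injective_iff.2 (add_left_injective 4)) ?_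
    rintro l ⟨hl, -⟩
    rw [multisetWeight_map_add_four, hl]
  rw [gapGenFun, gapLists_add_four, h, ← X_pow_eq, ← pow_mul]

/-- Whatever may follow `x + 4` may follow `x`. Chains after `x` therefore split into those also
allowed after `x + 4`, which account for the factor `(X 0 ^ 4) ^ (s + 1)`, and those whose first
entry lies in `Y`. -/
theorem gapGenFun_succ (s x : ℕ) (Y : Finset ℕ)
    (hY : ∀ y, y ∈ Y ↔ GapRel x y ∧ ¬ GapRel (x + 4) y) :
    (1 - (X 0 ^ 4) ^ (s + 1)) * gapGenFun (s + 1) x =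
      ∑ y ∈ Y, monomial (partWeight 4 3 y) 1 * gapGenFun s y := by
  have hset : gapLists (s + 1) x =
      gapLists (s + 1) (x + 4) ∪ ⋃ y ∈ Y, List.cons y '' gapLists s y := by
    ext l
    cases l with
    | nil => simp [gapLists]
    | cons z l =>
      simp only [Set.mem_union, cons_mem_gapLists, Set.mem_iUnion, Set.mem_image, List.cons.injEq,
        exists_prop]
      constructor
      · rintro ⟨hz, hl⟩
        by_cases h : GapRel (x + 4) z
        · exact Or.inl ⟨h, hl⟩
        · exact Or.inr ⟨z, (hY z).2 ⟨hz, h⟩, l, hl, rfl, rfl⟩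
      · rintro (⟨hz, hl⟩ | ⟨y, hy, l, hl, rfl, rfl⟩)
        · exact ⟨hz.of_add_four, hl⟩
        · exact ⟨((hY y).1 hy).1, hl⟩
  have hdisj : Disjoint (gapLists (s + 1) (x + 4)) (⋃ y ∈ Y, List.cons y '' gapLists s y) := by
    rw [Set.disjoint_iUnion₂_right]
    intro y hy
    rw [Set.disjoint_right]
    rintro _ ⟨l, -, rfl⟩ h
    exact ((hY y).1 hy).2 (cons_mem_gapLists.1 h).1
  have hsub : (⋃ y ∈ Y, List.cons y '' gapLists s y) ⊆ gapLists (s + 1) x :=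
    hset ▸ Set.subset_union_right
  have h : gapGenFun (s + 1) x = gapGenFun (s + 1) (x + 4) +
      ∑ y ∈ Y, monomial (partWeight 4 3 y) 1 * gapGenFun s y := by
    conv_lhs => rw [gapGenFun, hset]
    rw [setGenFun_union hdisj (finite_gapLists_weight _ _)
      (fun e => (finite_gapLists_weight (s + 1) x e).subset fun l hl => ⟨hsub hl.1, hl.2⟩),
      setGenFun_biUnion]
    · refine congrArg₂ _ rfl (Finset.sum_congr rfl fun y _ => ?_)
      exact setGenFun_image (List.cons_injective) fun l _ => by
        rw [← Multiset.cons_coe, multisetWeight_cons]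
    · intro y _ z _ hyz
      rw [Set.disjoint_left]
      rintro _ ⟨l, -, rfl⟩ ⟨l', -, h⟩
      exact hyz (List.cons.inj h).1.symm
    · intro y hy e
      exact (finite_gapLists_weight (s + 1) x e).subset fun l hl =>
        ⟨hsub (Set.mem_biUnion hy hl.1), hl.2⟩
  rw [gapGenFun_add_four] at h
  linear_combination h

local notation "q" => (X 0 : MvPowerSeries (Fin 4) ℤ)
local notation "a" => (X 1 : MvPowerSeries (Fin 4) ℤ)
local notation "c" => (X 2 : MvPowerSeries (Fin 4) ℤ)
local notation "d" => (X 3 : MvPowerSeries (Fin 4) ℤ)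

theorem gapGenFun_succ_zero (s : ℕ) :
    (1 - (q ^ 4) ^ (s + 1)) * gapGenFun (s + 1) 0 =
      gapGenFun s 0 + a * q * gapGenFun s 1 + c * q ^ 2 * gapGenFun s 2 +
        d * q ^ 7 * ((q ^ 4) ^ s * gapGenFun s 3) := by
  -- After 0 everything except 3 is allowed; after 4, everything from 4 on except 7.
  rw [gapGenFun_succ s 0 {0, 1, 2, 7} (by
    intro y; simp only [Finset.mem_insert, Finset.mem_singleton, GapRel, GapCondition]; omega),
    ← gapGenFun_add_four]
  simp [monomial_partWeight, Nat.ModEq]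
  ring

theorem gapGenFun_succ_of_one_or_two (s x : ℕ) (hx : x = 1 ∨ x = 2) :
    (1 - (q ^ 4) ^ (s + 1)) * gapGenFun (s + 1) x =
      q ^ 8 * ((q ^ 4) ^ s * ((q ^ 4) ^ s * gapGenFun s 0)) +
        a * q ^ 9 * ((q ^ 4) ^ s * ((q ^ 4) ^ s * gapGenFun s 1)) + c * q ^ 2 * gapGenFun s 2 +
        d * q ^ 7 * ((q ^ 4) ^ s * gapGenFun s 3) := by
  rw [gapGenFun_succ s x {8, 9, 2, 7} (by
    intro y; simp only [Finset.mem_insert, Finset.mem_singleton, GapRel, GapCondition]; omega)]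
  simp only [← gapGenFun_add_four]
  simp [monomial_partWeight, Nat.ModEq]
  ring

/-- The same entries may follow 3 and 4: the gap condition forbids 3 and 7 after 3. -/
theorem gapGenFun_three (s : ℕ) : gapGenFun s 3 = (q ^ 4) ^ s * gapGenFun s 0 := by
  rw [← gapGenFun_add_four]
  have h : gapLists s 3 = gapLists s (0 + 4) := by
    cases s with
    | zero => rw [gapLists_zero, gapLists_zero]
    | succ s =>
      ext l
      cases l with
      | nil => simp [gapLists]
      | cons y l =>
        rw [cons_mem_gapLists, cons_mem_gapLists]
        refine and_congr_left fun _ => ?_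
        unfold GapRel GapCondition; omega
  rw [gapGenFun, h, gapGenFun]

/-- The same entries may follow 1 and 2, since 1 cannot repeat. -/
theorem gapGenFun_two (s : ℕ) : gapGenFun s 2 = gapGenFun s 1 := by
  have h : gapLists s 2 = gapLists s 1 := by
    cases s with
    | zero => rw [gapLists_zero, gapLists_zero]
    | succ s =>
      ext l
      cases l with
      | nil => simp [gapLists]
      | cons y l =>
        rw [cons_mem_gapLists, cons_mem_gapLists]
        refine and_congr_left fun _ => ?_
        unfold GapRel GapCondition; omega
  rw [gapGenFun, h, gapGenFun]

/-- The generating functions `gapGenFun s 0`, multiplied by `(q⁴; q⁴)ₛ`, are the polynomials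
`gapPoly`. -/
theorem prod_mul_gapGenFun (s : ℕ) :
    (∏ i ∈ Finset.range s, (1 - q ^ 4 * (q ^ 4) ^ i)) * gapGenFun s 0 =
      gapPoly (a * q) (c * q ^ 2) (d * q ^ 7) (q ^ 8) s := by
  set P : ℕ → MvPowerSeries (Fin 4) ℤ := fun s => ∏ i ∈ Finset.range s, (1 - q ^ 4 * (q ^ 4) ^ i)
    with hP
  have hPs (s : ℕ) : P (s + 1) = P s * (1 - (q ^ 4) ^ (s + 1)) := by
    simp only [hP, Finset.prod_range_succ]; ring
  have hZ (s : ℕ) : P (s + 1) * gapGenFun (s + 1) 0 =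
      (1 + d * q ^ 7 * (q ^ 8) ^ s) * (P s * gapGenFun s 0) +
        (a * q + c * q ^ 2) * (P s * gapGenFun s 1) := by
    have h := gapGenFun_succ_zero s
    rw [gapGenFun_three, gapGenFun_two] at h
    rw [hPs, mul_assoc, h]
    ring
  have hU (s : ℕ) : P (s + 1) * gapGenFun (s + 1) 1 =
      ((q ^ 8) ^ (s + 1) + d * q ^ 7 * (q ^ 8) ^ s) * (P s * gapGenFun s 0) +
        (a * q * (q ^ 8) ^ (s + 1) + c * q ^ 2) * (P s * gapGenFun s 1) := by
    have h := gapGenFun_succ_of_one_or_two s 1 (Or.inl rfl)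
    rw [gapGenFun_three, gapGenFun_two] at h
    rw [hPs, mul_assoc, h]
    ring
  change P s * gapGenFun s 0 = _
  induction s using Nat.twoStepInduction with
  | zero => simp [hP, gapGenFun_zero, gapPoly]
  | one =>
    rw [hZ 0]
    simp only [hP, gapGenFun_zero, gapPoly, Finset.prod_range_zero]
    ring
  | more s ih₁ ih₂ =>
    rw [gapPoly, ← ih₁, ← ih₂, hZ (s + 1), hU s]
    -- The relation `hZ s` is solved for the series of chains following 1, which is thereby
    -- eliminated.
    linear_combination (-(a * q * (q ^ 8) ^ (s + 1)) - c * q ^ 2) * hZ s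

end Recurrence

/-! ### From zero-padded chains to the partitions counted by `A4`. -/

theorem exists_rel_of_isChain_cons {α : Type*} {r : α → α → Prop} {x y : α} {l : List α}
    (h : (x :: l).IsChain r) (hy : y ∈ l) : ∃ z, r z y := by
  induction l generalizing x with
  | nil => simp at hy
  | cons z l ih =>
    rw [List.isChain_cons_cons] at h
    rcases List.mem_cons.1 hy with rfl | hy
    · exact ⟨x, h.1⟩
    · exact ih h.2 hy

theorem isChain_and {α : Type*} {r r' : α → α → Prop} {l : List α} (h : l.IsChain r)
    (h' : l.IsChain r') : l.IsChain fun x y => r x y ∧ r' x y := by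
  induction l with
  | nil => exact .nil
  | cons x l ih =>
    rw [List.isChain_cons] at h h' ⊢
    exact ⟨fun y hy => ⟨h.1 y hy, h'.1 y hy⟩, ih h.2 h'.2⟩

theorem isChain_gapRel_zero_replicate_append (k : ℕ) (l : List ℕ) :
    (0 :: (List.replicate k 0 ++ l)).IsChain GapRel ↔ (0 :: l).IsChain GapRel := by
  induction k with
  | zero => simp
  | succ k ih =>
    rw [List.replicate_succ, List.cons_append, List.isChain_cons_cons, ih]
    exact and_iff_right (by simp [GapRel, GapCondition])

/-- The virtual part 0 encodes the ban on 3: no number is allowed before a 3, while 0 is allowed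
before anything else. -/
theorem isChain_gapRel_zero_reverse {l : List ℕ} (hl : l.Pairwise (· ≥ ·)) :
    (0 :: l.reverse).IsChain GapRel ↔ 3 ∉ l ∧ l.IsChain GapCondition := by
  have hle : l.reverse.IsChain (fun x y => x ≤ y) := (List.pairwise_reverse.2 hl).isChain
  have hiff : l.reverse.IsChain GapRel ↔ l.IsChain GapCondition := by
    rw [← List.isChain_reverse (l := l)]
    exact ⟨fun h => h.imp fun _ _ h => h.2, fun h =>
      isChain_and hle h⟩
  constructor
  · intro h
    refine ⟨fun h3 => ?_, hiff.1 h.tail⟩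
    obtain ⟨z, hz⟩ := exists_rel_of_isChain_cons h (List.mem_reverse.2 h3)
    unfold GapRel GapCondition at hz
    omega
  · rintro ⟨h3, h⟩
    rw [List.isChain_cons]
    refine ⟨fun y hy => ?_, hiff.2 h⟩
    have hy3 : y ≠ 3 := fun h => h3 (h ▸ List.mem_reverse.1 (List.mem_of_mem_head? hy))
    unfold GapRel GapCondition
    omega

open MvPowerSeries in
theorem coeff_gapGenFun_zero {s : ℕ} {e : Fin 4 →₀ ℕ} (hs : e 0 ≤ s) :
    coeff e (gapGenFun s 0) = A4 (e 0) (e 1) (e 2) (e 3) := by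
  rw [gapGenFun, coeff_setGenFun, A4, Nat.cast_inj, ← Set.ncard_coe_finset]
  symm
  have hcard (p : (e 0).Partition) : p.parts.card ≤ s := by
    refine le_trans ?_ hs
    have := Multiset.card_nsmul_le_sum (s := p.parts) (a := 1) fun x hx => p.parts_pos hx
    simpa [p.parts_sum] using this
  have hcoe (p : (e 0).Partition) (k : ℕ) :
      ((List.replicate k 0 ++ (p.parts.sort (· ≥ ·)).reverse : List ℕ) : Multiset ℕ) =
        Multiset.replicate k 0 + p.parts := by
    rw [← Multiset.coe_add, Multiset.coe_reverse, Multiset.sort_eq, Multiset.coe_replicate]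
  have hfilter (p : (e 0).Partition) (k : ℕ) :
      (Multiset.replicate k 0 + p.parts).filter (· ≠ 0) = p.parts := by
    rw [Multiset.filter_add, Multiset.filter_eq_nil.2, Multiset.filter_eq_self.2, zero_add]
    · exact fun x hx => (p.parts_pos hx).ne'
    · exact fun x hx h => h (Multiset.eq_of_mem_replicate hx)
  -- A partition of `e 0` has at most `e 0 ≤ s` parts, so padding to length `s` is possible;
  -- discarding zeros inverts it. Zeros affect neither the sum nor the counts of residues 1, 2, 3.
  refine Set.ncard_congr (fun p _ =>
    List.replicate (s - p.parts.card) 0 ++ (p.parts.sort (· ≥ ·)).reverse) ?_ ?_ ?_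
  · intro p hp
    simp only [Finset.coe_filter, Finset.mem_univ, true_and, Set.mem_ofPred_eq] at hp
    obtain ⟨h1, h2, h3, hp3, hch⟩ := hp
    refine ⟨⟨?_, ?_⟩, ?_⟩
    · simp [Nat.sub_add_cancel (hcard p)]
    · rw [isChain_gapRel_zero_replicate_append,
        isChain_gapRel_zero_reverse (Multiset.pairwise_sort _ _)]
      exact ⟨by simpa using hp3, hch⟩
    · have hz (r : ℕ) (hr : ¬ 0 ≡ r [MOD 4]) (k : ℕ) :
          (Multiset.replicate k 0).countP (fun x => x ≡ r [MOD 4]) = 0 :=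
        Multiset.countP_eq_zero.2 fun x hx => (Multiset.eq_of_mem_replicate hx) ▸ hr
      rw [hcoe, multisetWeight_eq_iff]
      simp only [Multiset.countP_add, Multiset.sum_add, hz 1 (by decide), hz 2 (by decide),
        hz 3 (by decide), zero_add, p.parts_sum]
      exact ⟨by simp, h1, h2, h3⟩
  · intro p p' _ _ h
    have h' := congrArg (fun l : List ℕ => (l : Multiset ℕ).filter (· ≠ 0)) h
    simp only [hcoe] at h'
    rw [hfilter, hfilter] at h'
    exact Nat.Partition.ext h'
  · rintro l ⟨⟨hlen, hch⟩, hw⟩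
    obtain ⟨h0, h1, h2, h3⟩ := (multisetWeight_eq_iff 4 3 _ e).1 hw
    let p : (e 0).Partition := Nat.Partition.ofSums (e 0) l h0
    have hp : p.parts = (l : Multiset ℕ).filter (· ≠ 0) := rfl
    have hsort : l.Pairwise (· ≤ ·) :=
      (List.isChain_iff_pairwise.1 (hch.imp fun _ _ h => h.1)).tail
    have hl : List.replicate (s - p.parts.card) 0 ++ (p.parts.sort (· ≥ ·)).reverse = l := by
      refine List.Perm.eq_of_pairwise' (r := (· ≤ ·)) ?_ hsort ?_
      · rw [List.pairwise_append]
        refine ⟨List.pairwise_replicate.2 (Or.inr le_rfl),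
          List.pairwise_reverse.2 (Multiset.pairwise_sort _ _), ?_⟩
        intro x hx y _
        rw [List.eq_of_mem_replicate hx]
        exact Nat.zero_le y
      · rw [← Multiset.coe_eq_coe, hcoe]
        conv_rhs => rw [← Multiset.filter_add_not (· = 0) (l : Multiset ℕ)]
        have hz : (l : Multiset ℕ).filter (· = 0) =
            Multiset.replicate ((l : Multiset ℕ).filter (· = 0)).card 0 :=
          Multiset.eq_replicate_card.2 fun x hx => (Multiset.mem_filter.1 hx).2
        have hc := congrArg Multiset.card (Multiset.filter_add_not (· = 0) (l : Multiset ℕ))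
        rw [Multiset.card_add, Multiset.coe_card, hlen] at hc
        rw [hz, hp]
        congr 2
        simp only [ne_eq] at *
        omega
    refine ⟨p, ?_, hl⟩
    have hcount (r : ℕ) (hr : ¬ 0 ≡ r [MOD 4]) : p.parts.countP (fun x => x ≡ r [MOD 4]) =
        (l : Multiset ℕ).countP (fun x => x ≡ r [MOD 4]) := by
      rw [hp, Multiset.countP_filter]
      refine Multiset.countP_congr rfl fun x _ => ?_
      exact propext (and_iff_left_of_imp fun h h0 => hr (h0 ▸ h))
    rw [← hl, isChain_gapRel_zero_replicate_append,
      isChain_gapRel_zero_reverse (Multiset.pairwise_sort _ _), Multiset.mem_sort] at hch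
    exact Finset.mem_coe.2 (Finset.mem_filter.2 ⟨Finset.mem_univ _,
      (hcount 1 (by decide)).trans h1, (hcount 2 (by decide)).trans h2,
      (hcount 3 (by decide)).trans h3, hch⟩)

/-! ### The product side: multisets with bounded parts. -/

/-- The condition on a part `x` of a multiset `s`: it is even and not congruent to `6` modulo `8`,
or it has multiplicity one and is congruent to `±1` modulo `8`. -/
def ProductPart (s : Multiset ℕ) (x : ℕ) : Prop :=
  (Even x ∧ x % 8 ≠ 6) ∨ (s.count x = 1 ∧ (x % 8 = 1 ∨ x % 8 = 7))

/-- The multisets of admissible parts in `[1, N]`. -/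
def productMultisets (N : ℕ) : Set (Multiset ℕ) :=
  {s | ∀ x ∈ s, 0 < x ∧ x ≤ N ∧ ProductPart s x}

/-- The generating function of `productMultisets N`. -/
noncomputable def productGenFun (N : ℕ) : MvPowerSeries (Fin 4) ℤ :=
  setGenFun (multisetWeight 8 7) (productMultisets N)

theorem productPart_cons_of_ne {s : Multiset ℕ} {x y : ℕ} (h : x ≠ y) :
    ProductPart (y ::ₘ s) x ↔ ProductPart s x := by
  rw [ProductPart, ProductPart, Multiset.count_cons_of_ne h]

theorem mem_productMultisets_of_notMem {N : ℕ} {s : Multiset ℕ}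
    (hs : s ∈ productMultisets (N + 1)) (h : N + 1 ∉ s) : s ∈ productMultisets N := by
  intro x hx
  obtain ⟨h1, h2, h3⟩ := hs x hx
  have : x ≠ N + 1 := fun hx' => h (hx' ▸ hx)
  exact ⟨h1, by omega, h3⟩

theorem productMultisets_subset_succ (N : ℕ) : productMultisets N ⊆ productMultisets (N + 1) :=
  fun _ hs x hx => ⟨(hs x hx).1, (hs x hx).2.1.trans (Nat.le_succ N), (hs x hx).2.2⟩

theorem succ_notMem_of_mem_productMultisets {N : ℕ} {s : Multiset ℕ}
    (hs : s ∈ productMultisets N) : N + 1 ∉ s :=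
  fun h => absurd (hs _ h).2.1 (by omega)

theorem disjoint_productMultisets_cons (N : ℕ) (S : Set (Multiset ℕ)) :
    Disjoint (productMultisets N) (Multiset.cons (N + 1) '' S) := by
  rw [Set.disjoint_left]
  rintro _ hs ⟨s, -, rfl⟩
  exact succ_notMem_of_mem_productMultisets hs (Multiset.mem_cons_self _ _)

/-- Removing one copy of `N + 1` leaves a multiset of the same kind, since repetition is allowed;
this yields a geometric series factor. -/
theorem productMultisets_succ_of_even {N : ℕ} (h : Even (N + 1) ∧ (N + 1) % 8 ≠ 6) :
    productMultisets (N + 1) =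
      productMultisets N ∪ Multiset.cons (N + 1) '' productMultisets (N + 1) := by
  have hcons (x : ℕ) (s : Multiset ℕ) :
      ProductPart ((N + 1) ::ₘ s) x ↔ ProductPart s x := by
    by_cases hx : x = N + 1
    · subst hx; exact ⟨fun _ => Or.inl h, fun _ => Or.inl h⟩
    · exact productPart_cons_of_ne hx
  ext s
  constructor
  · intro hs
    by_cases hN : N + 1 ∈ s
    · obtain ⟨t, rfl⟩ := Multiset.exists_cons_of_mem hN
      refine Or.inr ⟨t, fun x hx => ?_, rfl⟩
      obtain ⟨h1, h2, h3⟩ := hs x (Multiset.mem_cons_of_mem hx)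
      exact ⟨h1, h2, (hcons x t).1 h3⟩
    · exact Or.inl (mem_productMultisets_of_notMem hs hN)
  · rintro (hs | ⟨t, ht, rfl⟩)
    · exact productMultisets_subset_succ N hs
    · intro x hx
      rcases Multiset.mem_cons.1 hx with rfl | hx
      · exact ⟨Nat.succ_pos N, le_rfl, Or.inl h⟩
      · obtain ⟨h1, h2, h3⟩ := ht x hx
        exact ⟨h1, h2, (hcons x t).2 h3⟩

theorem productMultisets_succ_of_odd {N : ℕ} (h : (N + 1) % 8 = 1 ∨ (N + 1) % 8 = 7) :
    productMultisets (N + 1) =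
      productMultisets N ∪ Multiset.cons (N + 1) '' productMultisets N := by
  have hodd : ¬ Even (N + 1) := by rw [Nat.even_iff]; omega
  ext s
  constructor
  · intro hs
    by_cases hN : N + 1 ∈ s
    · obtain ⟨t, rfl⟩ := Multiset.exists_cons_of_mem hN
      refine Or.inr ⟨t, fun x hx => ?_, rfl⟩
      have hNt : N + 1 ∉ t := by
        rcases (hs _ hN).2.2 with h' | h'
        · exact absurd h'.1 hodd
        · rw [Multiset.count_cons_self, Nat.add_eq_right] at h'
          exact Multiset.count_eq_zero.1 h'.1
      have hx' : x ≠ N + 1 := fun h' => hNt (h' ▸ hx)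
      obtain ⟨h1, h2, h3⟩ := hs x (Multiset.mem_cons_of_mem hx)
      exact ⟨h1, by omega, (productPart_cons_of_ne hx').1 h3⟩
    · exact Or.inl (mem_productMultisets_of_notMem hs hN)
  · rintro (hs | ⟨t, ht, rfl⟩)
    · exact productMultisets_subset_succ N hs
    · have hNt := succ_notMem_of_mem_productMultisets ht
      intro x hx
      rcases Multiset.mem_cons.1 hx with rfl | hx
      · refine ⟨Nat.succ_pos N, le_rfl, Or.inr ⟨?_, h⟩⟩
        rw [Multiset.count_cons_self, Multiset.count_eq_zero.2 hNt]
      · obtain ⟨h1, h2, h3⟩ := ht x hx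
        exact ⟨h1, h2.trans (Nat.le_succ N),
          (productPart_cons_of_ne fun h' : x = N + 1 => hNt (h' ▸ hx)).2 h3⟩

theorem productMultisets_succ_of_not {N : ℕ} (h₁ : ¬ (Even (N + 1) ∧ (N + 1) % 8 ≠ 6))
    (h₂ : ¬ ((N + 1) % 8 = 1 ∨ (N + 1) % 8 = 7)) :
    productMultisets (N + 1) = productMultisets N := by
  refine (Set.Subset.antisymm ?_ (productMultisets_subset_succ N))
  intro s hs
  refine mem_productMultisets_of_notMem hs fun hN => ?_
  rcases (hs _ hN).2.2 with h | h
  · exact h₁ h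
  · exact h₂ h.2

theorem productMultisets_zero : productMultisets 0 = {0} := by
  ext s
  rw [Set.mem_singleton_iff]
  constructor
  · intro hs
    refine Multiset.eq_zero_of_forall_notMem fun x hx => ?_
    obtain ⟨h1, h2, -⟩ := hs x hx
    omega
  · rintro rfl x hx
    exact absurd hx (Multiset.notMem_zero x)

theorem finite_productMultisets_weight (N : ℕ) (e : Fin 4 →₀ ℕ) :
    {s ∈ productMultisets N | multisetWeight 8 7 s = e}.Finite := by
  refine (Set.finite_range (Nat.Partition.parts (n := e 0))).subset ?_
  rintro s ⟨hs, he⟩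
  exact ⟨⟨s, fun hx => (hs _ hx).1, ((multisetWeight_eq_iff 8 7 s e).1 he).1⟩, rfl⟩

section Recurrence

open MvPowerSeries

theorem coeff_productGenFun {N : ℕ} {e : Fin 4 →₀ ℕ} (hN : e 0 ≤ N) :
    coeff e (productGenFun N) = B4 (e 0) (e 1) (e 2) (e 3) := by
  rw [productGenFun, coeff_setGenFun, B4, Nat.cast_inj, ← Set.ncard_coe_finset]
  symm
  refine Set.ncard_congr (fun p _ => p.parts) ?_ (fun p p' _ _ h => Nat.Partition.ext h) ?_
  · intro p hp
    obtain ⟨-, h1, h2, h3, h⟩ := Finset.mem_filter.1 (Finset.mem_coe.1 hp)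
    refine ⟨fun x hx => ⟨p.parts_pos hx, (p.le_of_mem_parts hx).trans hN, h x hx⟩, ?_⟩
    exact (multisetWeight_eq_iff 8 7 _ e).2 ⟨p.parts_sum, h1, h2, h3⟩
  · rintro s ⟨hs, he⟩
    obtain ⟨h0, h1, h2, h3⟩ := (multisetWeight_eq_iff 8 7 s e).1 he
    exact ⟨⟨s, fun hx => (hs _ hx).1, h0⟩, Finset.mem_coe.2 (Finset.mem_filter.2
      ⟨Finset.mem_univ _, h1, h2, h3, fun x hx => (hs x hx).2.2⟩), rfl⟩

theorem productGenFun_zero : productGenFun 0 = 1 := by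
  rw [productGenFun, productMultisets_zero, setGenFun_singleton]
  rfl

theorem productGenFun_succ_of_even {N : ℕ} (h : Even (N + 1) ∧ (N + 1) % 8 ≠ 6) :
    (1 - monomial (partWeight 8 7 (N + 1)) 1) * productGenFun (N + 1) = productGenFun N := by
  have h' : productGenFun (N + 1) = productGenFun N +
      monomial (partWeight 8 7 (N + 1)) 1 * productGenFun (N + 1) := by
    conv_lhs => rw [productGenFun, productMultisets_succ_of_even h]
    rw [setGenFun_union (disjoint_productMultisets_cons N _)
      (finite_productMultisets_weight N), setGenFun_image (fun _ _ => (Multiset.cons_inj_right _).1)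
      fun s _ => multisetWeight_cons 8 7 _ s]
    · rfl
    · refine fun e => (finite_productMultisets_weight (N + 1) e).subset fun s hs => ⟨?_, hs.2⟩
      rw [productMultisets_succ_of_even h]
      exact Or.inr hs.1
  linear_combination h'

theorem productGenFun_succ_of_odd {N : ℕ} (h : (N + 1) % 8 = 1 ∨ (N + 1) % 8 = 7) :
    productGenFun (N + 1) = (1 + monomial (partWeight 8 7 (N + 1)) 1) * productGenFun N := by
  conv_lhs => rw [productGenFun, productMultisets_succ_of_odd h]
  rw [setGenFun_union (disjoint_productMultisets_cons N _) (finite_productMultisets_weight N),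
    setGenFun_image (fun _ _ => (Multiset.cons_inj_right _).1)
    fun s _ => multisetWeight_cons 8 7 _ s, productGenFun]
  · ring
  · refine fun e => (finite_productMultisets_weight (N + 1) e).subset fun s hs => ⟨?_, hs.2⟩
    rw [productMultisets_succ_of_odd h]
    exact Or.inr hs.1

theorem productGenFun_succ_of_not {N : ℕ} (h₁ : ¬ (Even (N + 1) ∧ (N + 1) % 8 ≠ 6))
    (h₂ : ¬ ((N + 1) % 8 = 1 ∨ (N + 1) % 8 = 7)) :
    productGenFun (N + 1) = productGenFun N := by
  rw [productGenFun, productMultisets_succ_of_not h₁ h₂, productGenFun]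

local notation "q" => (X 0 : MvPowerSeries (Fin 4) ℤ)
local notation "a" => (X 1 : MvPowerSeries (Fin 4) ℤ)
local notation "c" => (X 2 : MvPowerSeries (Fin 4) ℤ)
local notation "d" => (X 3 : MvPowerSeries (Fin 4) ℤ)

/-- In a block of eight sizes, residues 1 and 7 give the numerator factors, 2 the factor with `c`,
and 4 and 8 two consecutive factors of `(q⁴; q⁴)`. -/
theorem productGenFun_add_eight (M : ℕ) :
    productGenFun (8 * M + 8) * ((1 - q ^ 4 * (q ^ 4) ^ (2 * M)) *
        (1 - q ^ 4 * (q ^ 4) ^ (2 * M + 1)) * (1 - c * q ^ 2 * (q ^ 8) ^ M)) =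
      (1 + a * q * (q ^ 8) ^ M) * (1 + d * q ^ 7 * (q ^ 8) ^ M) * productGenFun (8 * M) := by
  have h1 := productGenFun_succ_of_odd (N := 8 * M) (by omega)
  have h2 := productGenFun_succ_of_even (N := 8 * M + 1) (by rw [Nat.even_iff]; omega)
  have h3 := productGenFun_succ_of_not (N := 8 * M + 2) (by rw [Nat.even_iff]; omega) (by omega)
  have h4 := productGenFun_succ_of_even (N := 8 * M + 3) (by rw [Nat.even_iff]; omega)
  have h5 := productGenFun_succ_of_not (N := 8 * M + 4) (by rw [Nat.even_iff]; omega) (by omega)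
  have h6 := productGenFun_succ_of_not (N := 8 * M + 5) (by rw [Nat.even_iff]; omega) (by omega)
  have h7 := productGenFun_succ_of_odd (N := 8 * M + 6) (by omega)
  have h8 := productGenFun_succ_of_even (N := 8 * M + 7) (by rw [Nat.even_iff]; omega)
  simp only [add_assoc, Nat.reduceAdd] at h1 h2 h3 h4 h5 h6 h7 h8
  simp only [monomial_partWeight, Nat.ModEq, Nat.mul_add_mod, Nat.reduceMod, Nat.reduceEqDiff,
    if_true, if_false, pow_zero, pow_one, mul_one, OfNat.ofNat_ne_one,
    OfNat.zero_ne_ofNat, OfNat.one_ne_ofNat, zero_ne_one] at h1 h2 h4 h7 h8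
  rw [h1] at h2
  rw [h3] at h4
  rw [h7, h6, h5] at h8
  linear_combination (1 - q ^ (8 * M + 4)) * (1 - q ^ (8 * M + 2) * c) * h8 +
    (1 + q ^ (8 * M + 7) * d) * (1 - q ^ (8 * M + 2) * c) * h4 + (1 + q ^ (8 * M + 7) * d) * h2

theorem productGenFun_mul_prod (M : ℕ) :
    productGenFun (8 * M) * ((∏ i ∈ Finset.range (2 * M), (1 - q ^ 4 * (q ^ 4) ^ i)) *
        ∏ i ∈ Finset.range M, (1 - c * q ^ 2 * (q ^ 8) ^ i)) =
      (∏ i ∈ Finset.range M, (1 + a * q * (q ^ 8) ^ i)) *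
        ∏ i ∈ Finset.range M, (1 + d * q ^ 7 * (q ^ 8) ^ i) := by
  induction M with
  | zero => simp [productGenFun_zero]
  | succ M ih =>
    simp only [Nat.mul_succ, Finset.prod_range_succ]
    linear_combination (∏ i ∈ Finset.range (2 * M), (1 - q ^ 4 * (q ^ 4) ^ i)) *
      (∏ i ∈ Finset.range M, (1 - c * q ^ 2 * (q ^ 8) ^ i)) * productGenFun_add_eight M +
      (1 + a * q * (q ^ 8) ^ M) * (1 + d * q ^ 7 * (q ^ 8) ^ M) * ih

end Recurrence

/-! ### Passage to the infinite products. -/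

section Limits

open MvPowerSeries Filter Topology

theorem multipliable_one_sub_mul_pow {x y : MvPowerSeries (Fin 4) ℤ}
    (hy : constantCoeff y = 0) : Multipliable fun i : ℕ => 1 - x * y ^ i := by
  simp only [sub_eq_add_neg]
  refine WithPiTopology.multipliable_one_add_of_tendsto_order_atTop_nhds_top ?_
  rw [ENat.tendsto_nhds_top_iff_natCast_lt]
  intro n
  filter_upwards [eventually_gt_atTop n] with i hi
  rw [← neg_mul]
  exact (Nat.cast_lt.2 hi).trans_le ((le_order_pow_of_constantCoeff_eq_zero i hy).trans
    (le_add_self.trans le_order_mul))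

theorem tendsto_prod_qPochInf {x y : MvPowerSeries (Fin 4) ℤ} (hy : constantCoeff y = 0) :
    Tendsto (fun n => ∏ i ∈ Finset.range n, (1 - x * y ^ i)) atTop (𝓝 (qPochInf x y)) :=
  (multipliable_one_sub_mul_pow hy).hasProd.tendsto_prod_nat

theorem tendsto_of_eventually_coeff_eq {f : ℕ → MvPowerSeries (Fin 4) ℤ}
    {g : MvPowerSeries (Fin 4) ℤ} (h : ∀ e, ∀ᶠ n in atTop, coeff e (f n) = coeff e g) :
    Tendsto f atTop (𝓝 g) :=
  (WithPiTopology.tendsto_iff_coeff_tendsto ..).2 fun e =>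
    tendsto_const_nhds.congr' ((h e).mono fun _ h => h.symm)

theorem constantCoeff_qPochInf {x y : MvPowerSeries (Fin 4) ℤ} (hx : constantCoeff x = 0)
    (hy : constantCoeff y = 0) : constantCoeff (qPochInf x y) = 1 := by
  refine tendsto_nhds_unique ((WithPiTopology.continuous_constantCoeff ℤ).continuousAt.tendsto.comp
    (tendsto_prod_qPochInf hy)) (tendsto_const_nhds.congr fun n => ?_)
  simp [hx]

/-- The generating function of the numbers `B4`. -/
noncomputable def B4GenFun : MvPowerSeries (Fin 4) ℤ :=
  fun e => (B4 (e 0) (e 1) (e 2) (e 3) : ℤ)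

theorem tendsto_gapGenFun : Tendsto (fun s => gapGenFun s 0) atTop (𝓝 A4GenFun) :=
  tendsto_of_eventually_coeff_eq fun e =>
    (eventually_ge_atTop (e 0)).mono fun _ hs => coeff_gapGenFun_zero hs

theorem tendsto_productGenFun : Tendsto productGenFun atTop (𝓝 B4GenFun) :=
  tendsto_of_eventually_coeff_eq fun e =>
    (eventually_ge_atTop (e 0)).mono fun _ hN => coeff_productGenFun hN

local notation "q" => (X 0 : MvPowerSeries (Fin 4) ℤ)
local notation "a" => (X 1 : MvPowerSeries (Fin 4) ℤ)
local notation "c" => (X 2 : MvPowerSeries (Fin 4) ℤ)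
local notation "d" => (X 3 : MvPowerSeries (Fin 4) ℤ)

theorem tendsto_prod_mul_prod :
    Tendsto (fun s => (∏ i ∈ Finset.range s, (1 + a * q * (q ^ 8) ^ i)) *
        ∏ i ∈ Finset.range s, (1 + d * q ^ 7 * (q ^ 8) ^ i)) atTop
      (𝓝 (qPochInf (-(a * q)) (q ^ 8) * qPochInf (-(d * q ^ 7)) (q ^ 8))) := by
  have h := (tendsto_prod_qPochInf (x := -(a * q)) (y := q ^ 8) (by simp)).mul
    (tendsto_prod_qPochInf (x := -(d * q ^ 7)) (y := q ^ 8) (by simp))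
  simpa only [neg_mul, sub_neg_eq_add] using h

theorem A4GenFun_mul :
    A4GenFun * (qPochInf (q ^ 4) (q ^ 4) * qPochInf (c * q ^ 2) (q ^ 8)) =
      qPochInf (-(a * q)) (q ^ 8) * qPochInf (-(d * q ^ 7)) (q ^ 8) := by
  have h := (tendsto_gapGenFun.mul ((tendsto_prod_qPochInf (x := q ^ 4) (y := q ^ 4)
    (by simp)).mul (tendsto_prod_qPochInf (x := c * q ^ 2) (y := q ^ 8) (by simp)))).sub
    tendsto_prod_mul_prod
  refine sub_eq_zero.1 (tendsto_nhds_unique h (tendsto_of_eventually_coeff_eq fun e => ?_))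
  -- At stage `s` the two sides differ by a multiple of `q ^ s`, which has no effect on coefficients
  -- of `q`-degree below `s`.
  filter_upwards [eventually_gt_atTop (e 0)] with s hs
  have hdvd := pow_dvd_gapPoly_mul_prod_sub (A := a * q) (C := c * q ^ 2)
    (E := d * q ^ 7) (p := q ^ 8) (dvd_mul_left q a) ((dvd_pow_self _ two_ne_zero).mul_left _)
    (dvd_pow_self _ (by norm_num)) (le_refl s) (le_refl s)
  rw [← prod_mul_gapGenFun, mul_comm (∏ i ∈ _, _) (gapGenFun s 0), mul_assoc] at hdvd
  rw [map_zero]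
  exact X_pow_dvd_iff.1 hdvd e hs

theorem B4GenFun_mul :
    B4GenFun * (qPochInf (q ^ 4) (q ^ 4) * qPochInf (c * q ^ 2) (q ^ 8)) =
      qPochInf (-(a * q)) (q ^ 8) * qPochInf (-(d * q ^ 7)) (q ^ 8) := by
  have h8 : Tendsto (fun M : ℕ => 8 * M) atTop atTop :=
    tendsto_id.const_mul_atTop' (by norm_num)
  have h2 : Tendsto (fun M : ℕ => 2 * M) atTop atTop :=
    tendsto_id.const_mul_atTop' (by norm_num)
  refine tendsto_nhds_unique ((tendsto_productGenFun.comp h8).mul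
    (((tendsto_prod_qPochInf (x := q ^ 4) (y := q ^ 4) (by simp)).comp h2).mul
      (tendsto_prod_qPochInf (x := c * q ^ 2) (y := q ^ 8) (by simp))))
    (tendsto_prod_mul_prod.congr fun M => (productGenFun_mul_prod M).symm)

theorem isUnit_qPochInf_mul :
    IsUnit (qPochInf (q ^ 4) (q ^ 4) * qPochInf (c * q ^ 2) (q ^ 8)) := by
  rw [isUnit_iff_constantCoeff, map_mul, constantCoeff_qPochInf (by simp) (by simp),
    constantCoeff_qPochInf (by simp) (by simp), one_mul]
  exact isUnit_one

theorem A4_eq_B4 (n k l m : ℕ) : A4 n k l m = B4 n k l m := by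
  have h : A4GenFun = B4GenFun :=
    isUnit_qPochInf_mul.mul_right_cancel (A4GenFun_mul.trans B4GenFun_mul.symm)
  have h' := congrFun h (Finsupp.equivFunOnFinite.symm ![n, k, l, m])
  simpa [A4GenFun, B4GenFun] using h'

end Limits

theorem mainTheorem3 :
    -- the formal variables
    let q : MvPowerSeries (Fin 4) ℤ := MvPowerSeries.X 0
    let a : MvPowerSeries (Fin 4) ℤ := MvPowerSeries.X 1
    let c : MvPowerSeries (Fin 4) ℤ := MvPowerSeries.X 2
    let d : MvPowerSeries (Fin 4) ℤ := MvPowerSeries.X 3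
    -- the four infinite products converge and the denominator is invertible
    (Multipliable (fun i : ℕ => 1 - (-(a * q)) * (q ^ 8) ^ i) ∧
      Multipliable (fun i : ℕ => 1 - (-(d * q ^ 7)) * (q ^ 8) ^ i) ∧
      Multipliable (fun i : ℕ => 1 - q ^ 4 * (q ^ 4) ^ i) ∧
      Multipliable (fun i : ℕ => 1 - (c * q ^ 2) * (q ^ 8) ^ i)) ∧
    IsUnit (qPochInf (q ^ 4) (q ^ 4) * qPochInf (c * q ^ 2) (q ^ 8)) ∧
    -- the product formula
    A4GenFun =
      qPochInf (-(a * q)) (q ^ 8) * qPochInf (-(d * q ^ 7)) (q ^ 8) *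
        Ring.inverse (qPochInf (q ^ 4) (q ^ 4) * qPochInf (c * q ^ 2) (q ^ 8)) ∧
    -- the partition identity
    ∀ n k l m : ℕ, A4 n k l m = B4 n k l m := by

  intro q a c d
  have hq4 : (q ^ 4).constantCoeff = 0 := by simp [q]
  have hq8 : (q ^ 8).constantCoeff = 0 := by simp [q]
  refine ⟨⟨multipliable_one_sub_mul_pow hq8, multipliable_one_sub_mul_pow hq8,
    multipliable_one_sub_mul_pow hq4, multipliable_one_sub_mul_pow hq8⟩,
    isUnit_qPochInf_mul, ?_, A4_eq_B4⟩
  exact (Ring.eq_mul_inverse_iff_mul_eq _ _ _ isUnit_qPochInf_mul).2 A4GenFun_mul
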